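/- Let $\mathbf{k}$ be a commutative ring. A *weak composition* of length $k$ is a tuple $\alpha=(\alpha_1,\dots,\alpha_k)\in\mathbb{N}^k$ (with $0\in\mathbb{N}$); its size is $|\alpha|=\alpha_1+\cdots+\alpha_k$; it is a *composition* if all $\alpha_i>0$. A *(weak) mopiscotion* is a pair $(\alpha,\sigma)$ of a (weak) composition $\alpha$ of some length $k\ge 0$ and a permutation $\sigma\in\mathfrak{S}_k$. For a weak mopiscotion $(\alpha,\sigma)$, let $j_1<\cdots<j_h$ be the indices $i$ with $\alpha_i\ne 0$, and let $\tau\in\mathfrak{S}_h$ be the standardization of the list $(\sigma(j_1),\dots,\sigma(j_h))$ (that is, $\tau(a)$ is the rank of $\sigma(j_a)$ in the set $\{\sigma(j_1),\dots,\sigma(j_h)\}$). Let $(\alpha,\sigma)^{\mathrm{red}}$ be the mopiscotion $((\alpha_{j_1},\dots,\alpha_{j_h}),\tau)$. Let $\mathrm{PNSym}$ be the free $\mathbf{k}$-module with basis $(F_{\alpha,\sigma})$ indexed by all mopiscotions, and set $F_{\alpha,\sigma}:=F_{(\alpha,\sigma)^{\mathrm{red}}}$ for every weak mopiscotion $(\alpha,\sigma)$.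 For mopiscotions $(\alpha,\sigma)$, $(\beta,\tau)$ with $\alpha$ of length $k$ and $\beta$ of length $\ell$, define bilinear products (external $\cdot$ and internal $\ast$) and a linear comultiplication by $$F_{\alpha,\sigma}\cdot F_{\beta,\tau}=F_{\alpha\beta,\,\sigma\oplus\tau},\qquad F_{\alpha,\sigma}\ast F_{\beta,\tau}=\sum_{\gamma}F_{(\gamma_{1,1},\gamma_{1,2},\dots,\gamma_{k,\ell}),\,\tau[\sigma]},\qquad \Delta(F_{\alpha,\sigma})=\sum_{\beta+\gamma=\alpha}F_{\beta,\sigma}\otimes F_{\gamma,\sigma}.$$ Here $\alpha\beta$ is the concatenation; $\sigma\oplus\tau\in\mathfrak{S}_{k+\ell}$ sends $i\le k$ to $\sigma(i)$ and $j>k$ to $k+\tau(j-k)$; the second sum is over all matrices $\gamma\in\mathbb{N}^{k\times\ell}$ with row sums $\alpha_1,\dots,\alpha_k$ and column sums $\beta_1,\dots,\beta_\ell$, read row by row; $\tau[\sigma]\in\mathfrak{S}_{k\ell}$ sends $\ell(i-1)+j$ to $k(\tau(j)-1)+\sigma(i)$ for $i\in[k]$, $j\in[\ell]$; and the last sum is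 over all pairs of weak compositions with entrywise sum $\alpha$. Let the unity be $F_{\varnothing,\varnothing}$, let the counit $\varepsilon$ be the linear map with $\varepsilon(F_{\varnothing,\varnothing})=1$ and $\varepsilon(F_{\alpha,\sigma})=0$ for every nonempty composition $\alpha$, and let $F_{\alpha,\sigma}$ be homogeneous of degree $|\alpha|$. **Theorem.** (a) $\mathrm{PNSym}$ with the external product $\cdot$, the unity $F_{\varnothing,\varnothing}$, the comultiplication $\Delta$, the counit $\varepsilon$ and the above grading is a connected graded cocommutative Hopf algebra over $\mathbf{k}$ (connected means that the degree-$0$ component is $\mathbf{k}\cdot 1$; graded means that multiplication, unit, comultiplication and counit respect the grading). (b) $\mathrm{PNSym}$ with the internal product $\ast$, the comultiplication $\Delta$ and the counit $\varepsilon$ is a (non-graded) non-unital bialgebra: $\ast$ is associative, $(\Delta,\varepsilon)$ is a coalgebra structure, and $\Delta(f\ast g)=\Delta(f)\ast\Delta(g)$ and $\varepsilon(f\ast g)=\varepsilon(f)\,\varepsilon(g)$ for all $f,g$. In particular, both $\cdot$ and $\ast$ are associative. -/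

import Mathlib

universe u

open scoped TensorProduct

/-- A weak mopiscotion `(α, σ)`: a tuple `α = (α₁, …, α_k)` of nonnegative integers together with a
permutation `σ` of the index set of `α` (indices run over `Fin k`, i.e. they start at `0`). -/
structure WeakMopiscotion where
  /-- the length `k` of `α` -/
  len : ℕ
  /-- the weak composition `α` -/
  parts : Fin len → ℕ
  /-- the permutation `σ` -/
  perm : Equiv.Perm (Fin len)

namespace WeakMopiscotion

/-- The size `|α| = α₁ + ⋯ + α_k`. -/
def size (w : WeakMopiscotion) : ℕ := ∑ i, w.parts i

/-- The set `{j₁ < ⋯ < j_h}` of all indices `i` with `α_i ≠ 0`. -/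
def support (w : WeakMopiscotion) : Finset (Fin w.len) :=
  Finset.univ.filter fun i => w.parts i ≠ 0

/-- The standardization of the list `(σ(j₁), …, σ(j_h))`: the permutation that sends `a` to the rank
of `σ(j_a)` in the set `{σ(j₁), …, σ(j_h)}`. -/
def redPerm (w : WeakMopiscotion) : Equiv.Perm (Fin w.support.card) :=
  ((w.support.orderIsoOfFin rfl).toEquiv.trans
      (w.perm.subtypeEquiv (q := fun b => b ∈ w.support.map w.perm.toEmbedding)
        fun a => by simp)).trans
    ((w.support.map w.perm.toEmbedding).orderIsoOfFin (Finset.card_map _)).toEquiv.symm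

/-- The concatenation `(αβ, σ ⊕ τ)`; the permutation `σ ⊕ τ` acts as `σ` on the first `k` indices
and as (shifted) `τ` on the last `ℓ` indices. -/
def concat (v w : WeakMopiscotion) : WeakMopiscotion where
  len := v.len + w.len
  parts := Fin.append v.parts w.parts
  perm := finSumFinEquiv.permCongr (Equiv.sumCongr v.perm w.perm)

/-- For `σ ∈ 𝔖_k` and `τ ∈ 𝔖_ℓ`, the permutation `τ[σ] ∈ 𝔖_{kℓ}` that sends `ℓ i + j` to
`k τ(j) + σ(i)` for all `i < k` and `j < ℓ`. -/
def bracket {k l : ℕ} (τ : Equiv.Perm (Fin l)) (σ : Equiv.Perm (Fin k)) :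
    Equiv.Perm (Fin (k * l)) :=
  finProdFinEquiv.symm.trans <| (Equiv.prodComm (Fin k) (Fin l)).trans <|
    (Equiv.prodCongr τ σ).trans <| finProdFinEquiv.trans (finCongr (Nat.mul_comm l k))

/-- For `(α, σ)`, `(β, τ)` and a `k × ℓ`-matrix `γ`, the weak mopiscotion
`((γ₁₁, γ₁₂, …, γ_{kℓ}), τ[σ])` obtained by reading `γ` row by row. -/
def ofTable (v w : WeakMopiscotion) (γ : Fin v.len → Fin w.len → ℕ) : WeakMopiscotion where
  len := v.len * w.len
  parts p := γ (finProdFinEquiv.symm p).1 (finProdFinEquiv.symm p).2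
  perm := bracket w.perm v.perm

/-- The set of contingency tables: matrices of nonnegative integers with row sums `α` and column
sums `β`. -/
def tables {k l : ℕ} (α : Fin k → ℕ) (β : Fin l → ℕ) : Finset (Fin k → Fin l → ℕ) :=
  (Fintype.piFinset fun i => Finset.piAntidiag Finset.univ (α i)).filter
    fun γ => ∀ j, ∑ i, γ i j = β j

theorem mem_tables {k l : ℕ} {α : Fin k → ℕ} {β : Fin l → ℕ} {γ : Fin k → Fin l → ℕ} :
    γ ∈ tables α β ↔ (∀ i, ∑ j, γ i j = α i) ∧ ∀ j, ∑ i, γ i j = β j := by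
  simp [tables]

/-- The set of pairs `(β, γ)` of weak compositions with entrywise sum `β + γ = α`. -/
def splittings {k : ℕ} (α : Fin k → ℕ) : Finset ((Fin k → ℕ) × (Fin k → ℕ)) :=
  (Fintype.piFinset fun i => Finset.HasAntidiagonal.antidiagonal (α i)).map
    (Equiv.arrowProdEquivProdArrow (Fin k) (fun _ => ℕ) (fun _ => ℕ)).toEmbedding

theorem mem_splittings {k : ℕ} {α : Fin k → ℕ} {p : (Fin k → ℕ) × (Fin k → ℕ)} :
    p ∈ splittings α ↔ p.1 + p.2 = α := by
  simp [splittings, funext_iff, Finset.mem_map_equiv, Equiv.arrowProdEquivProdArrow]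

end WeakMopiscotion

/-- A mopiscotion: a weak mopiscotion `(α, σ)` such that `α` is a composition, i.e. all entries
of `α` are positive. -/
def Mopiscotion : Type := {w : WeakMopiscotion // ∀ i, 0 < w.parts i}

/-- The mopiscotion `(α, σ)^red`: remove the zero entries of `α` and standardize `σ`. -/
def WeakMopiscotion.red (w : WeakMopiscotion) : Mopiscotion :=
  ⟨{ len := w.support.card
     parts := fun a => w.parts (w.support.orderIsoOfFin rfl a)
     perm := w.redPerm },
    fun a => Nat.pos_of_ne_zero
      (Finset.mem_filter.mp (w.support.orderIsoOfFin rfl a).2).2⟩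

theorem WeakMopiscotion.ext_cast {v w : WeakMopiscotion} (h : v.len = w.len)
    (hp : ∀ i, v.parts i = w.parts (Fin.cast h i))
    (hs : ∀ i, (v.perm i : ℕ) = w.perm (Fin.cast h i)) : v = w := by
  obtain ⟨n, p, s⟩ := v
  obtain ⟨m, q, t⟩ := w
  obtain rfl : n = m := h
  obtain rfl : p = q := funext hp
  obtain rfl : s = t := Equiv.ext fun i => Fin.ext (hs i)
  rfl

theorem Finset.coe_orderIsoOfFin_of_eq_univ {n m : ℕ} (s : Finset (Fin n)) (hs : s = Finset.univ)
    (h : s.card = m) (a : Fin m) : ((s.orderIsoOfFin h a : Fin n) : ℕ) = a := by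
  subst hs
  obtain rfl : n = m := by simpa using h
  have := Finset.orderEmbOfFin_unique h (f := id) (fun _ => Finset.mem_univ _) strictMono_id
  rw [Finset.coe_orderIsoOfFin_apply, ← this, id]

/-- Reduction fixes every mopiscotion, so that `F_{α,σ}` is unambiguous. -/
theorem Mopiscotion.red_eq (a : Mopiscotion) : a.1.red = a := by
  have hu : a.1.support = Finset.univ :=
    Finset.filter_true_of_mem fun i _ => (a.2 i).ne'
  have hu' : a.1.support.map a.1.perm.toEmbedding = Finset.univ := by simp [hu]
  have hc : a.1.support.card = a.1.len := by simp [hu]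
  have key : ∀ i, (a.1.support.orderIsoOfFin rfl i : Fin a.1.len) = Fin.cast hc i := fun i =>
    Fin.ext (Finset.coe_orderIsoOfFin_of_eq_univ _ hu rfl i)
  have hperm : ∀ i : Fin a.1.support.card, (a.1.redPerm i : ℕ) = a.1.perm (Fin.cast hc i) := by
    intro i
    rw [← key i, ← Finset.coe_orderIsoOfFin_of_eq_univ _ hu' (Finset.card_map _) (a.1.redPerm i)]
    simp [WeakMopiscotion.redPerm]
  exact Subtype.ext
    (WeakMopiscotion.ext_cast hc (fun i => congrArg a.1.parts (key i)) fun i => hperm i)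

/-- The empty mopiscotion `(∅, ∅)`. -/
def Mopiscotion.empty : Mopiscotion := ⟨⟨0, Fin.elim0, 1⟩, fun i => i.elim0⟩

/-- `PNSym`: the free `k`-module on the set of mopiscotions. -/
def PNSym (k : Type u) [CommRing k] : Type u := Mopiscotion →₀ k

namespace PNSym

variable (k : Type u) [CommRing k]

noncomputable instance : AddCommGroup (PNSym k) := inferInstanceAs (AddCommGroup (Mopiscotion →₀ k))

noncomputable instance : Module k (PNSym k) := inferInstanceAs (Module k (Mopiscotion →₀ k))

/-- The defining basis `(F_{α,σ})` of `PNSym`, indexed by the mopiscotions. -/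
noncomputable def basis : Module.Basis Mopiscotion k (PNSym k) := Finsupp.basisSingleOne

/-- `F_{α,σ} := F_{(α,σ)^red}` for a weak mopiscotion `(α, σ)`. -/
noncomputable def F (w : WeakMopiscotion) : PNSym k := basis k w.red

theorem F_mopiscotion (a : Mopiscotion) : F k a.1 = basis k a :=
  congrArg (basis k) a.red_eq

/-- The external multiplication: the bilinear map with
`F_{α,σ} · F_{β,τ} = F_{αβ, σ ⊕ τ}` for all mopiscotions. -/
noncomputable def extMul : PNSym k →ₗ[k] PNSym k →ₗ[k] PNSym k :=
  (basis k).constr k fun a => (basis k).constr k fun b => F k (a.1.concat b.1)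

/-- The internal multiplication: the bilinear map with
`F_{α,σ} ∗ F_{β,τ} = ∑_γ F_{(γ₁₁, …, γ_{kℓ}), τ[σ]}` for all mopiscotions, the sum ranging over
the contingency tables `γ` with row sums `α` and column sums `β`. -/
noncomputable def intMul : PNSym k →ₗ[k] PNSym k →ₗ[k] PNSym k :=
  (basis k).constr k fun a => (basis k).constr k fun b =>
    ∑ γ ∈ WeakMopiscotion.tables a.1.parts b.1.parts, F k (a.1.ofTable b.1 γ)

/-- The comultiplication: the linear map with
`Δ(F_{α,σ}) = ∑_{β + γ = α} F_{β,σ} ⊗ F_{γ,σ}` for all mopiscotions. -/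
noncomputable def comul : PNSym k →ₗ[k] PNSym k ⊗[k] PNSym k :=
  (basis k).constr k fun a =>
    ∑ p ∈ WeakMopiscotion.splittings a.1.parts,
      F k ⟨a.1.len, p.1, a.1.perm⟩ ⊗ₜ[k] F k ⟨a.1.len, p.2, a.1.perm⟩

/-- The counit: `ε(F_{∅,∅}) = 1` and `ε(F_{α,σ}) = 0` for all nonempty `α`. -/
noncomputable def counit : PNSym k →ₗ[k] k :=
  (basis k).constr k fun a => if a.1.len = 0 then 1 else 0

/-- The unity `F_{∅,∅}` of the external multiplication. -/
noncomputable def one : PNSym k := basis k Mopiscotion.empty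

/-- The degree-`n` component: the span of all `F_{α,σ}` with `|α| = n`. -/
noncomputable def grade (n : ℕ) : Submodule k (PNSym k) :=
  Submodule.span k (basis k '' {a | a.1.size = n})

end PNSym

/-- A non-unital bialgebra: a non-unital (associative) `k`-algebra that is also a (counital,
coassociative) `k`-coalgebra, such that the comultiplication and the counit are multiplicative. -/
class NonUnitalBialgebra (k A : Type*) [CommRing k] [NonUnitalRing A] [Module k A]
    [IsScalarTower k A A] [SMulCommClass k A A] extends Coalgebra k A where
  comul_mul : ∀ a b : A, comul (a * b) = comul a * comul b
  counit_mul : ∀ a b : A, counit (a * b) = counit a * counit b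

/-! The defining formulas are stated on mopiscotions, but products and splittings produce zero
parts. The key point is that all four formulas (both products, `Δ`, `ε`) hold verbatim for `F` of
weak mopiscotions: `extMul_F`, `intMul_F`, `comul_F`, `counit_F`. The reason is that `red` embeds as
a pattern of the original pair, and `F` does not change when zero parts are dropped along any
pattern embedding (`red_comp`, `F_comp`). A zero part forces a zero in each splitting and a zero row
or column in each table, so the index sets of the sums do not change either.

Each axiom then becomes a bijection between index sets. Associativity of `∗` holds because both
bracketings sum over three-dimensional arrays with prescribed plane sums (`sum_tables_assoc`) and
`τ[σ]` is associative (`bracket_assoc`). Multiplicativity of `Δ` for `∗` holds because splitting a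
table entrywise also splits its row and column sums (`sum_tables_splittings`).

For the antipode, `1 - id` kills degree `0`, hence is locally nilpotent under convolution, and `id =
1 - (1 - id)` is inverted by a geometric series. -/

namespace WeakMopiscotion

/-! ### Patterns and invariance of the reduction under zero parts -/

/-- The strictly increasing map `f` exhibits `σ` as a pattern of `τ`. -/
structure IsPattern {n m : ℕ} (σ : Equiv.Perm (Fin n)) (τ : Equiv.Perm (Fin m))
    (f : Fin n → Fin m) : Prop where
  strictMono : StrictMono f
  perm_lt : ∀ ⦃i j⦄, σ i < σ j → τ (f i) < τ (f j)

namespace IsPattern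

variable {l m n : ℕ} {ρ : Equiv.Perm (Fin l)} {σ σ' : Equiv.Perm (Fin m)} {τ : Equiv.Perm (Fin n)}

theorem comp {g : Fin m → Fin n} {f : Fin l → Fin m} (hg : IsPattern σ τ g)
    (hf : IsPattern ρ σ f) : IsPattern ρ τ (g ∘ f) :=
  ⟨hg.strictMono.comp hf.strictMono, fun _ _ h => hg.perm_lt (hf.perm_lt h)⟩

theorem perm_lt_iff {f : Fin m → Fin n} (hf : IsPattern σ τ f) {i j : Fin m} :
    τ (f i) < τ (f j) ↔ σ i < σ j := by
  refine ⟨fun h => ?_, fun h => hf.perm_lt h⟩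
  rcases lt_trichotomy (σ i) (σ j) with h' | h' | h'
  · exact h'
  · rw [σ.injective h'] at h
    exact absurd h (lt_irrefl _)
  · exact absurd (hf.perm_lt h') h.not_gt

/-- Both permutations order indices as `τ ∘ f` does, so `σ' ∘ σ⁻¹` is a strictly increasing
bijection of `Fin m`, hence the identity. -/
theorem perm_unique {f : Fin m → Fin n} (h : IsPattern σ τ f) (h' : IsPattern σ' τ f) :
    σ = σ' := by
  have hmono : StrictMono fun a => σ' (σ.symm a) := fun a b hab => by
    rw [← h'.perm_lt_iff, h.perm_lt_iff]
    simpa using hab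
  have := (hmono.range_inj strictMono_id).mp
    ((σ.symm.trans σ').surjective.range_eq.trans Set.range_id.symm)
  ext i
  simpa using congrArg Fin.val (congrFun this (σ i)).symm

/-- A strictly increasing map is determined by its range, so the range together with `p` and `τ`
recovers length, parts and permutation. -/
theorem eq_of_range_eq {v v' : WeakMopiscotion} {f : Fin v.len → Fin n} {f' : Fin v'.len → Fin n}
    (h : IsPattern v.perm τ f) (h' : IsPattern v'.perm τ f') (hr : Set.range f = Set.range f')
    {p : Fin n → ℕ} (hp : v.parts = p ∘ f) (hp' : v'.parts = p ∘ f') : v = v' := by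
  obtain ⟨a, q, σ⟩ := v
  obtain ⟨b, q', σ'⟩ := v'
  dsimp only at *
  obtain rfl : a = b := by
    have h1 := Set.ncard_image_of_injective Set.univ h.strictMono.injective
    have h2 := Set.ncard_image_of_injective Set.univ h'.strictMono.injective
    rw [Set.image_univ, Set.ncard_univ, Nat.card_fin] at h1 h2
    rw [← h1, ← h2, hr]
  obtain rfl := (h.strictMono.range_inj h'.strictMono).mp hr
  rw [hp, hp', h.perm_unique h']

end IsPattern

/-- The strictly increasing enumeration of the indices of the nonzero parts. -/
def redEmb (w : WeakMopiscotion) (a : Fin w.red.1.len) : Fin w.len :=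
  w.support.orderIsoOfFin rfl a

theorem isPattern_red (w : WeakMopiscotion) : IsPattern w.red.1.perm w.perm w.redEmb := by
  refine ⟨fun a b h => (w.support.orderIsoOfFin rfl).strictMono h, fun a b h => ?_⟩
  have key : ∀ c : Fin w.support.card, ((w.support.map w.perm.toEmbedding).orderIsoOfFin
      (Finset.card_map _) (w.redPerm c) : Fin w.len) = w.perm (w.redEmb c) := fun c => by
    simp [redPerm, redEmb]
  rw [← key a, ← key b]
  exact ((w.support.map w.perm.toEmbedding).orderIsoOfFin (Finset.card_map _)).strictMono h

theorem range_redEmb (w : WeakMopiscotion) : Set.range w.redEmb = {i | w.parts i ≠ 0} := by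
  exact (Finset.range_orderEmbOfFin w.support rfl).trans (by ext; simp [support])

/-- Removing parts equal to `0` does not change the reduction. -/
theorem red_comp {n m : ℕ} {σ : Equiv.Perm (Fin n)} {τ : Equiv.Perm (Fin m)} {f : Fin n → Fin m}
    (hf : IsPattern σ τ f) {p : Fin m → ℕ} (hp : ∀ j, j ∉ Set.range f → p j = 0) :
    red ⟨n, p ∘ f, σ⟩ = red ⟨m, p, τ⟩ := by
  apply Subtype.ext
  -- Both reductions are patterns of `τ`; it remains to see that both embeddings have as range the
  -- set where `p` is nonzero.
  refine (hf.comp (isPattern_red ⟨n, p ∘ f, σ⟩)).eq_of_range_eq (isPattern_red ⟨m, p, τ⟩)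
    (p := p) ?_ rfl rfl
  rw [Set.range_comp]
  refine (congrArg _ (range_redEmb ⟨n, p ∘ f, σ⟩)).trans (Eq.trans ?_ (range_redEmb ⟨m, p, τ⟩).symm)
  ext j
  constructor
  · rintro ⟨i, hi, rfl⟩
    exact hi
  · intro hj
    obtain ⟨i, rfl⟩ := not_not.mp fun h => hj (hp j h)
    exact ⟨i, hj, rfl⟩

theorem exists_isPattern_red (w : WeakMopiscotion) : ∃ f : Fin w.red.1.len → Fin w.len,
    IsPattern w.red.1.perm w.perm f ∧ w.red.1.parts = w.parts ∘ f ∧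
      ∀ j, j ∉ Set.range f → w.parts j = 0 :=
  ⟨_, w.isPattern_red, rfl, fun j hj => by simpa [w.range_redEmb] using hj⟩

/-! ### Splittings and tables after deletion of zero entries -/

section Sums

variable {M : Type*} [AddCommMonoid M]

/-- Where `α` vanishes both summands of a splitting vanish, so restriction along `f` is a bijection,
with extension by zero as inverse. -/
theorem sum_splittings_comp {n m : ℕ} {f : Fin n → Fin m} (hf : Function.Injective f)
    {α : Fin m → ℕ} (hα : ∀ j, j ∉ Set.range f → α j = 0)
    (G : (Fin n → ℕ) × (Fin n → ℕ) → M) :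
    ∑ q ∈ splittings (α ∘ f), G q = ∑ p ∈ splittings α, G (p.1 ∘ f, p.2 ∘ f) := by
  symm
  refine Finset.sum_bij (fun p _ => (p.1 ∘ f, p.2 ∘ f)) ?_ ?_ ?_ fun _ _ => rfl
  · intro p hp
    rw [mem_splittings] at hp ⊢
    rw [← hp]
    rfl
  · intro p hp q hq h
    rw [mem_splittings] at hp hq
    have hz : ∀ j, j ∉ Set.range f → p.1 j = q.1 j ∧ p.2 j = q.2 j := fun j hj => by
      have h1 := congrFun hp j
      have h2 := congrFun hq j
      have h3 := hα j hj
      simp only [Pi.add_apply] at h1 h2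
      omega
    rw [Prod.ext_iff] at h ⊢
    constructor <;> ext j <;> by_cases hj : j ∈ Set.range f
    · obtain ⟨i, rfl⟩ := hj
      exact congrFun h.1 i
    · exact (hz j hj).1
    · obtain ⟨i, rfl⟩ := hj
      exact congrFun h.2 i
    · exact (hz j hj).2
  · intro q hq
    rw [mem_splittings] at hq
    refine ⟨(Function.extend f q.1 0, Function.extend f q.2 0), ?_, ?_⟩
    · rw [mem_splittings]
      ext j
      by_cases hj : j ∈ Set.range f
      · obtain ⟨i, rfl⟩ := hj
        simpa [hf.extend_apply] using congrFun hq i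
      · simp [hα j hj, Function.extend_apply' _ _ _ (show ¬∃ a, f a = j from hj)]
    · simp [Function.extend_comp hf]

theorem apply_eq_zero_of_mem_tables {k l : ℕ} {α : Fin k → ℕ} {β : Fin l → ℕ}
    {γ : Fin k → Fin l → ℕ} (h : γ ∈ tables α β) {i : Fin k} {j : Fin l}
    (h0 : α i = 0 ∨ β j = 0) : γ i j = 0 := by
  rw [mem_tables] at h
  rcases h0 with h0 | h0
  · have := h.1 i
    rw [h0, Finset.sum_eq_zero_iff] at this
    exact this j (Finset.mem_univ _)
  · have := h.2 j
    rw [h0, Finset.sum_eq_zero_iff] at this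
    exact this i (Finset.mem_univ _)

theorem sum_comp_of_injective {n m : ℕ} {f : Fin n → Fin m} (hf : Function.Injective f)
    {p : Fin m → M} (hp : ∀ j, j ∉ Set.range f → p j = 0) : ∑ i, p (f i) = ∑ j, p j :=
  Finset.sum_of_injOn f hf.injOn (fun _ _ => Finset.mem_univ _)
    (fun j _ hj => hp j (by simpa using hj)) fun _ _ => rfl

/-- Rows and columns with sum `0` consist of zeros, so deleting them is a bijection on tables. -/
theorem sum_tables_comp {k k' l l' : ℕ} {f : Fin k → Fin k'} (hf : Function.Injective f)
    {g : Fin l → Fin l'} (hg : Function.Injective g) {α : Fin k' → ℕ} {β : Fin l' → ℕ}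
    (hα : ∀ j, j ∉ Set.range f → α j = 0) (hβ : ∀ j, j ∉ Set.range g → β j = 0)
    (G : (Fin k → Fin l → ℕ) → M) :
    ∑ γ ∈ tables (α ∘ f) (β ∘ g), G γ = ∑ γ ∈ tables α β, G fun i j => γ (f i) (g j) := by
  symm
  refine Finset.sum_bij (fun γ _ => fun i j => γ (f i) (g j)) ?_ ?_ ?_ fun _ _ => rfl
  · intro γ hγ
    have hγ' := mem_tables.mp hγ
    rw [mem_tables]
    constructor
    · intro i
      rw [Function.comp_apply, ← hγ'.1, sum_comp_of_injective hg (p := γ (f i))]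
      exact fun j hj => apply_eq_zero_of_mem_tables hγ (.inr (hβ j hj))
    · intro j
      rw [Function.comp_apply, ← hγ'.2, sum_comp_of_injective hf (p := fun i => γ i (g j))]
      exact fun i hi => apply_eq_zero_of_mem_tables hγ (.inl (hα i hi))
  · intro γ hγ δ hδ h
    ext i j
    by_cases hi : i ∈ Set.range f
    · by_cases hj : j ∈ Set.range g
      · obtain ⟨i, rfl⟩ := hi
        obtain ⟨j, rfl⟩ := hj
        exact congrFun (congrFun h i) j
      · rw [apply_eq_zero_of_mem_tables hγ (.inr (hβ j hj)),
          apply_eq_zero_of_mem_tables hδ (.inr (hβ j hj))]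
    · rw [apply_eq_zero_of_mem_tables hγ (.inl (hα i hi)),
        apply_eq_zero_of_mem_tables hδ (.inl (hα i hi))]
  · intro γ hγ
    rw [mem_tables] at hγ
    have hfg : Function.Injective (Prod.map f g) := hf.prodMap hg
    -- The preimage of `γ` is its extension by zero outside the selected rows and columns.
    let e : Fin k' × Fin l' → ℕ := Function.extend (Prod.map f g) (fun x => γ x.1 x.2) 0
    have he : ∀ i j, e (f i, g j) = γ i j := fun i j => hfg.extend_apply _ _ (i, j)
    have he1 : ∀ i j, i ∉ Set.range f → e (i, j) = 0 := fun i j hi =>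
      Function.extend_apply' _ _ _ fun ⟨a, ha⟩ => hi ⟨a.1, congrArg Prod.fst ha⟩
    have he2 : ∀ i j, j ∉ Set.range g → e (i, j) = 0 := fun i j hj =>
      Function.extend_apply' _ _ _ fun ⟨a, ha⟩ => hj ⟨a.2, congrArg Prod.snd ha⟩
    refine ⟨fun i j => e (i, j), ?_, ?_⟩
    · rw [mem_tables]
      constructor
      · intro i
        by_cases hi : i ∈ Set.range f
        · obtain ⟨i, rfl⟩ := hi
          rw [← sum_comp_of_injective hg fun j hj => he2 _ j hj]
          simpa only [he, Function.comp_apply] using hγ.1 i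
        · simp [he1 i _ hi, hα i hi]
      · intro j
        by_cases hj : j ∈ Set.range g
        · obtain ⟨j, rfl⟩ := hj
          rw [← sum_comp_of_injective hf fun i hi => he1 i _ hi]
          simpa only [he, Function.comp_apply] using hγ.2 j
        · simp [he2 _ j hj, hβ j hj]
    · ext i j
      exact he i j

end Sums

end WeakMopiscotion

/-! ### Patterns in `σ ⊕ τ` and `τ[σ]` -/

namespace WeakMopiscotion

theorem castAdd_lt_natAdd {n m : ℕ} (i : Fin n) (j : Fin m) : Fin.castAdd m i < Fin.natAdd n j := by
  rw [Fin.lt_def, Fin.val_castAdd, Fin.val_natAdd]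
  omega

theorem IsPattern.sum {k k' l l' : ℕ} {σ : Equiv.Perm (Fin k)} {σ' : Equiv.Perm (Fin k')}
    {τ : Equiv.Perm (Fin l)} {τ' : Equiv.Perm (Fin l')} {f : Fin k → Fin k'}
    {g : Fin l → Fin l'} (hf : IsPattern σ σ' f) (hg : IsPattern τ τ' g) :
    IsPattern (finSumFinEquiv.permCongr (Equiv.sumCongr σ τ))
      (finSumFinEquiv.permCongr (Equiv.sumCongr σ' τ'))
      (Fin.append (fun i => Fin.castAdd l' (f i)) fun j => Fin.natAdd k' (g j)) := by
  have hc : ∀ {m n : ℕ} {i j : Fin m}, Fin.castAdd n i < Fin.castAdd n j ↔ i < j := Iff.rfl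
  constructor
  · intro i j
    cases i using Fin.addCases <;> cases j using Fin.addCases <;>
      simp [castAdd_lt_natAdd, (castAdd_lt_natAdd _ _).not_gt, hc, hf.strictMono.lt_iff_lt,
        hg.strictMono.lt_iff_lt]
  · intro i j
    cases i using Fin.addCases <;> cases j using Fin.addCases <;>
      simp [Equiv.permCongr_apply, castAdd_lt_natAdd, (castAdd_lt_natAdd _ _).not_gt, hc,
        hf.perm_lt_iff, hg.perm_lt_iff]

theorem finProdFinEquiv_lt_iff {m n : ℕ} {a a' : Fin m} {b b' : Fin n} :
    finProdFinEquiv (a, b) < finProdFinEquiv (a', b') ↔ a < a' ∨ a = a' ∧ b < b' := by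
  simp only [Fin.lt_def, finProdFinEquiv_apply_val, Fin.ext_iff]
  have h1 := b.2
  have h2 := b'.2
  rcases lt_trichotomy (a : ℕ) a' with h | h | h
  · have : n * (a + 1) ≤ n * a' := Nat.mul_le_mul_left _ h
    simp only [h, true_or, iff_true]
    nlinarith
  · simp [h]
  · have : n * (a' + 1) ≤ n * a := Nat.mul_le_mul_left _ h
    have h3 : ¬ ((a : ℕ) < a') := by omega
    have h4 : ¬ ((a : ℕ) = a') := by omega
    simp only [h3, h4, false_and, or_self, iff_false, not_lt]
    nlinarith

theorem bracket_apply {k l : ℕ} (τ : Equiv.Perm (Fin l)) (σ : Equiv.Perm (Fin k)) (i : Fin k)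
    (j : Fin l) :
    bracket τ σ (finProdFinEquiv (i, j)) =
      Fin.cast (Nat.mul_comm l k) (finProdFinEquiv (τ j, σ i)) := by
  simp [bracket]

/-- Positions are ordered lexicographically by `(i, j)` and the values of `τ[σ]` lexicographically
by `(τ j, σ i)`; the embeddings `f` and `g` preserve both orders. -/
theorem IsPattern.bracket {k k' l l' : ℕ} {σ : Equiv.Perm (Fin k)} {σ' : Equiv.Perm (Fin k')}
    {τ : Equiv.Perm (Fin l)} {τ' : Equiv.Perm (Fin l')} {f : Fin k → Fin k'}
    {g : Fin l → Fin l'} (hf : IsPattern σ σ' f) (hg : IsPattern τ τ' g) :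
    IsPattern (bracket τ σ) (WeakMopiscotion.bracket τ' σ') fun p =>
      finProdFinEquiv (f (finProdFinEquiv.symm p).1, g (finProdFinEquiv.symm p).2) := by
  constructor
  · intro p q
    obtain ⟨⟨i, j⟩, rfl⟩ := finProdFinEquiv.surjective p
    obtain ⟨⟨i', j'⟩, rfl⟩ := finProdFinEquiv.surjective q
    simp only [Equiv.symm_apply_apply, finProdFinEquiv_lt_iff]
    rw [hf.strictMono.lt_iff_lt, hg.strictMono.lt_iff_lt, hf.strictMono.injective.eq_iff]
    exact id
  · intro p q
    obtain ⟨⟨i, j⟩, rfl⟩ := finProdFinEquiv.surjective p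
    obtain ⟨⟨i', j'⟩, rfl⟩ := finProdFinEquiv.surjective q
    simp only [Equiv.symm_apply_apply, bracket_apply, Fin.cast_lt_cast, finProdFinEquiv_lt_iff]
    rw [hf.perm_lt_iff, hg.perm_lt_iff, τ.injective.eq_iff, τ'.injective.eq_iff,
      hg.strictMono.injective.eq_iff]
    exact id

end WeakMopiscotion

/-! ### The structure maps on `F` of weak mopiscotions -/

namespace PNSym

open WeakMopiscotion

variable (k : Type u) [CommRing k]

theorem F_comp {n m : ℕ} {σ : Equiv.Perm (Fin n)} {τ : Equiv.Perm (Fin m)} {f : Fin n → Fin m}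
    (hf : IsPattern σ τ f) {p : Fin m → ℕ} (hp : ∀ j, j ∉ Set.range f → p j = 0) :
    F k ⟨n, p ∘ f, σ⟩ = F k ⟨m, p, τ⟩ :=
  congrArg (basis k) (red_comp hf hp)

theorem extMul_basis (a b : Mopiscotion) :
    extMul k (basis k a) (basis k b) = F k (a.1.concat b.1) := by
  simp [extMul]

theorem intMul_basis (a b : Mopiscotion) :
    intMul k (basis k a) (basis k b) =
      ∑ γ ∈ tables a.1.parts b.1.parts, F k (a.1.ofTable b.1 γ) := by
  simp [intMul]

theorem comul_basis (a : Mopiscotion) :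
    comul k (basis k a) = ∑ p ∈ splittings a.1.parts,
      F k ⟨a.1.len, p.1, a.1.perm⟩ ⊗ₜ[k] F k ⟨a.1.len, p.2, a.1.perm⟩ := by
  simp [comul]

theorem counit_basis (a : Mopiscotion) :
    counit k (basis k a) = if a.1.len = 0 then 1 else 0 := by
  simp [counit]

theorem extMul_F (v w : WeakMopiscotion) : extMul k (F k v) (F k w) = F k (v.concat w) := by
  obtain ⟨f, hf, hp, hz⟩ := v.exists_isPattern_red
  obtain ⟨g, hg, hq, hz'⟩ := w.exists_isPattern_red
  refine (extMul_basis k v.red w.red).trans ?_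
  -- The product of the reductions is `v.concat w` with some zero parts removed.
  have := F_comp k (hf.sum hg) (p := (v.concat w).parts) ?_
  · refine Eq.trans (congrArg (F k) ?_) this
    simp only [concat, mk.injEq, heq_eq_eq, true_and, and_true]
    ext i
    cases i using Fin.addCases <;> simp [hp, hq]
  · intro j hj
    cases j using Fin.addCases with
    | left j =>
      simp only [concat, Fin.append_left]
      refine hz j fun ⟨i, hi⟩ => hj ⟨Fin.castAdd _ i, ?_⟩
      simp [hi]
    | right j =>
      simp only [concat, Fin.append_right]
      refine hz' j fun ⟨i, hi⟩ => hj ⟨Fin.natAdd _ i, ?_⟩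
      simp [hi]

theorem intMul_F (v w : WeakMopiscotion) :
    intMul k (F k v) (F k w) = ∑ γ ∈ tables v.parts w.parts, F k (v.ofTable w γ) := by
  obtain ⟨f, hf, hp, hz⟩ := v.exists_isPattern_red
  obtain ⟨g, hg, hq, hz'⟩ := w.exists_isPattern_red
  refine (intMul_basis k v.red w.red).trans ?_
  rw [hp, hq, sum_tables_comp hf.strictMono.injective hg.strictMono.injective hz hz']
  refine Finset.sum_congr rfl fun γ hγ => ?_
  have := F_comp k (hf.bracket hg) (p := (v.ofTable w γ).parts) ?_
  · refine Eq.trans (congrArg (F k) ?_) this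
    simp only [ofTable, mk.injEq, heq_eq_eq, true_and, and_true]
    ext p
    simp only [Function.comp_apply, Equiv.symm_apply_apply]
  · intro p hp
    refine apply_eq_zero_of_mem_tables hγ ?_
    -- An index outside the image pairs a missed row or a missed column, where the row or column sum
    -- is zero.
    by_contra! h
    obtain ⟨i, hi⟩ := not_not.mp fun h' => h.1 (hz _ h')
    obtain ⟨j, hj⟩ := not_not.mp fun h' => h.2 (hz' _ h')
    exact hp ⟨finProdFinEquiv (i, j), by
      simp only [Equiv.symm_apply_apply, hi, hj, Prod.mk.eta, Equiv.apply_symm_apply]⟩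

theorem comul_F (w : WeakMopiscotion) :
    comul k (F k w) = ∑ p ∈ splittings w.parts,
      F k ⟨w.len, p.1, w.perm⟩ ⊗ₜ[k] F k ⟨w.len, p.2, w.perm⟩ := by
  obtain ⟨f, hf, hp, hz⟩ := w.exists_isPattern_red
  refine (comul_basis k w.red).trans ?_
  rw [hp, sum_splittings_comp hf.strictMono.injective hz]
  refine Finset.sum_congr rfl fun p hp => ?_
  rw [mem_splittings] at hp
  have hz' : ∀ j, j ∉ Set.range f → p.1 j = 0 ∧ p.2 j = 0 := fun j hj => by
    have h1 := hz j hj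
    rw [← hp, Pi.add_apply] at h1
    omega
  rw [F_comp k hf fun j hj => (hz' j hj).1, F_comp k hf fun j hj => (hz' j hj).2]

/-- The reduction has length `0` exactly when there are no nonzero parts. -/
theorem counit_F (w : WeakMopiscotion) :
    counit k (F k w) = if w.parts = 0 then 1 else 0 := by
  refine (counit_basis k w.red).trans (if_congr ?_ rfl rfl)
  change w.support.card = 0 ↔ _
  simp [support, Finset.filter_eq_empty_iff, funext_iff]

end PNSym

/-! ### Combinatorial identities behind the bialgebra axioms -/

namespace WeakMopiscotion

/-- The weak mopiscotion of length `0`. -/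
def nil : WeakMopiscotion := ⟨0, Fin.elim0, 1⟩

theorem ext_cast' {v w : WeakMopiscotion} (h : v.len = w.len)
    (hp : ∀ i, v.parts (Fin.cast h.symm i) = w.parts i)
    (hs : ∀ i, (v.perm (Fin.cast h.symm i) : ℕ) = w.perm i) : v = w :=
  (ext_cast h.symm (fun i => (hp i).symm) fun i => (hs i).symm).symm

theorem permSum_castAdd {k l : ℕ} (σ : Equiv.Perm (Fin k)) (τ : Equiv.Perm (Fin l)) (i : Fin k) :
    finSumFinEquiv.permCongr (Equiv.sumCongr σ τ) (Fin.castAdd l i) = Fin.castAdd l (σ i) := by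
  simp [Equiv.permCongr_apply]

theorem permSum_natAdd {k l : ℕ} (σ : Equiv.Perm (Fin k)) (τ : Equiv.Perm (Fin l)) (i : Fin l) :
    finSumFinEquiv.permCongr (Equiv.sumCongr σ τ) (Fin.natAdd k i) = Fin.natAdd k (τ i) := by
  simp [Equiv.permCongr_apply]

theorem permSum_assoc {k l m : ℕ} (σ : Equiv.Perm (Fin k)) (τ : Equiv.Perm (Fin l))
    (ρ : Equiv.Perm (Fin m)) (i : Fin (k + l + m)) :
    (finSumFinEquiv.permCongr (Equiv.sumCongr
        (finSumFinEquiv.permCongr (Equiv.sumCongr σ τ)) ρ) i : ℕ) =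
      finSumFinEquiv.permCongr (Equiv.sumCongr σ
        (finSumFinEquiv.permCongr (Equiv.sumCongr τ ρ))) (Fin.cast (Nat.add_assoc k l m) i) := by
  cases i using Fin.addCases with
  | left i =>
    cases i using Fin.addCases with
    | left i =>
      rw [show Fin.cast (Nat.add_assoc k l m) (Fin.castAdd m (Fin.castAdd l i)) =
        Fin.castAdd (l + m) i from rfl]
      simp only [permSum_castAdd, Fin.val_castAdd]
    | right i =>
      rw [show Fin.cast (Nat.add_assoc k l m) (Fin.castAdd m (Fin.natAdd k i)) =
        Fin.natAdd k (Fin.castAdd m i) from rfl]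
      simp only [permSum_castAdd, permSum_natAdd, Fin.val_castAdd, Fin.val_natAdd]
  | right i =>
    rw [show Fin.cast (Nat.add_assoc k l m) (Fin.natAdd (k + l) i) =
        Fin.natAdd k (Fin.natAdd l i) by ext; simp [Nat.add_assoc]]
    simp only [permSum_natAdd, Fin.val_natAdd, Nat.add_assoc]

theorem nil_concat (w : WeakMopiscotion) : nil.concat w = w := by
  have hcast : ∀ i : Fin w.len, Fin.cast (Nat.zero_add _).symm i = Fin.natAdd 0 i :=
    fun i => by ext; simp
  refine ext_cast' (Nat.zero_add _) (fun i => ?_) fun i => ?_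
  · exact (congrArg (Fin.append Fin.elim0 w.parts) (hcast i)).trans (Fin.append_right _ _ _)
  · refine (congrArg Fin.val ((congrArg _ (hcast i)).trans (permSum_natAdd 1 w.perm i))).trans ?_
    simp

theorem concat_nil (w : WeakMopiscotion) : w.concat nil = w :=
  ext_cast' (Nat.add_zero _) (fun i => Fin.append_left _ _ i) fun i =>
    congrArg Fin.val (permSum_castAdd w.perm 1 i)

theorem concat_assoc (u v w : WeakMopiscotion) :
    (u.concat v).concat w = u.concat (v.concat w) :=
  ext_cast (Nat.add_assoc _ _ _) (congrFun (Fin.append_assoc u.parts v.parts w.parts))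
    (permSum_assoc u.perm v.perm w.perm)

theorem cast_finProdFinEquiv {k l m : ℕ} (i : Fin k) (j : Fin l) (c : Fin m) :
    Fin.cast (Nat.mul_assoc k l m) (finProdFinEquiv (finProdFinEquiv (i, j), c)) =
      finProdFinEquiv (i, finProdFinEquiv (j, c)) := by
  ext
  simp only [Fin.val_cast, finProdFinEquiv_apply_val]
  ring

/-- At position `(i, j, c)` both sides encode the triple `(ρ c, τ j, σ i)`. -/
theorem bracket_assoc {k l m : ℕ} (σ : Equiv.Perm (Fin k)) (τ : Equiv.Perm (Fin l))
    (ρ : Equiv.Perm (Fin m)) (p : Fin (k * l * m)) :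
    (bracket ρ (bracket τ σ) p : ℕ) =
      bracket (bracket ρ τ) σ (Fin.cast (Nat.mul_assoc k l m) p) := by
  obtain ⟨⟨p, c⟩, rfl⟩ := finProdFinEquiv.surjective p
  obtain ⟨⟨i, j⟩, rfl⟩ := finProdFinEquiv.surjective p
  simp only [cast_finProdFinEquiv, bracket_apply, Fin.val_cast, finProdFinEquiv_apply_val]
  ring

/-- The row-by-row reading of a matrix. -/
def flatten {k l : ℕ} (γ : Fin k → Fin l → ℕ) (p : Fin (k * l)) : ℕ :=
  γ (finProdFinEquiv.symm p).1 (finProdFinEquiv.symm p).2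

theorem flatten_apply {k l : ℕ} (γ : Fin k → Fin l → ℕ) (i : Fin k) (j : Fin l) :
    flatten γ (finProdFinEquiv (i, j)) = γ i j := by
  simp only [flatten, Equiv.symm_apply_apply]

theorem flatten_assoc {k l m : ℕ} {δ : Fin (k * l) → Fin m → ℕ} {δ' : Fin k → Fin (l * m) → ℕ}
    (h : ∀ i j c, δ (finProdFinEquiv (i, j)) c = δ' i (finProdFinEquiv (j, c)))
    (p : Fin (k * l * m)) : flatten δ p = flatten δ' (Fin.cast (Nat.mul_assoc k l m) p) := by
  obtain ⟨⟨p, c⟩, rfl⟩ := finProdFinEquiv.surjective p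
  obtain ⟨⟨i, j⟩, rfl⟩ := finProdFinEquiv.surjective p
  rw [cast_finProdFinEquiv, flatten_apply, flatten_apply, h]

/-- The intermediate tables `γ` and `γ'` are arbitrary: the outer reading uses only the length and
permutation of the inner factor, so only the three-dimensional array encoded by `δ` and `δ'`
matters. -/
theorem ofTable_assoc (u v w : WeakMopiscotion) {γ : Fin u.len → Fin v.len → ℕ}
    {δ : Fin (u.len * v.len) → Fin w.len → ℕ} {γ' : Fin v.len → Fin w.len → ℕ}
    {δ' : Fin u.len → Fin (v.len * w.len) → ℕ}
    (h : ∀ i j c, δ (finProdFinEquiv (i, j)) c = δ' i (finProdFinEquiv (j, c))) :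
    (u.ofTable v γ).ofTable w δ = u.ofTable (v.ofTable w γ') δ' :=
  ext_cast (Nat.mul_assoc _ _ _) (flatten_assoc h) (bracket_assoc u.perm v.perm w.perm)

section Sums

variable {M : Type*} [AddCommMonoid M]

theorem sum_splittings_comm {n : ℕ} (α : Fin n → ℕ) (G : (Fin n → ℕ) → (Fin n → ℕ) → M) :
    ∑ p ∈ splittings α, G p.1 p.2 = ∑ p ∈ splittings α, G p.2 p.1 :=
  Finset.sum_nbij' Prod.swap Prod.swap (fun p hp => by simpa [mem_splittings, add_comm] using hp)
    (fun p hp => by simpa [mem_splittings, add_comm] using hp) (fun _ _ => rfl) (fun _ _ => rfl)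
    fun _ _ => rfl

theorem sum_splittings_assoc {n : ℕ} (α : Fin n → ℕ)
    (G : (Fin n → ℕ) → (Fin n → ℕ) → (Fin n → ℕ) → M) :
    ∑ p ∈ splittings α, ∑ q ∈ splittings p.1, G q.1 q.2 p.2 =
      ∑ p ∈ splittings α, ∑ q ∈ splittings p.2, G p.1 q.1 q.2 := by
  rw [Finset.sum_sigma', Finset.sum_sigma']
  refine Finset.sum_nbij' (fun x => ⟨(x.2.1, x.2.2 + x.1.2), (x.2.2, x.1.2)⟩)
    (fun x => ⟨(x.1.1 + x.2.1, x.2.2), (x.1.1, x.2.1)⟩) ?_ ?_ ?_ ?_ fun _ _ => rfl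
  all_goals
    rintro ⟨⟨a, b⟩, c, d⟩ h
    simp only [Finset.mem_sigma, mem_splittings] at h ⊢
    obtain ⟨rfl, rfl⟩ := h
    simp [add_assoc]

theorem sum_splittings_append {m n : ℕ} (α : Fin m → ℕ) (β : Fin n → ℕ)
    (G : (Fin (m + n) → ℕ) → (Fin (m + n) → ℕ) → M) :
    ∑ p ∈ splittings (Fin.append α β), G p.1 p.2 =
      ∑ a ∈ splittings α, ∑ b ∈ splittings β, G (Fin.append a.1 b.1) (Fin.append a.2 b.2) := by
  rw [← Finset.sum_product']
  symm
  refine Finset.sum_nbij' (fun x => (Fin.append x.1.1 x.2.1, Fin.append x.1.2 x.2.2))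
    (fun p => ((fun i => p.1 (Fin.castAdd n i), fun i => p.2 (Fin.castAdd n i)),
      (fun i => p.1 (Fin.natAdd m i), fun i => p.2 (Fin.natAdd m i)))) ?_ ?_ ?_ ?_ fun _ _ => rfl
  · rintro ⟨⟨a, b⟩, c, d⟩ h
    simp only [Finset.mem_product, mem_splittings] at h ⊢
    obtain ⟨rfl, rfl⟩ := h
    ext i
    cases i using Fin.addCases <;> simp
  · rintro ⟨a, b⟩ h
    simp only [Finset.mem_product, mem_splittings] at h ⊢
    constructor
    · ext i
      simpa using congrFun h (Fin.castAdd n i)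
    · ext i
      simpa using congrFun h (Fin.natAdd m i)
  · rintro ⟨⟨a, b⟩, c, d⟩ h
    simp
  · rintro ⟨a, b⟩ h
    rw [Prod.mk.injEq]
    constructor <;> ext i <;> cases i using Fin.addCases <;> simp

theorem sum_fin_mul {k l : ℕ} (p : Fin (k * l) → M) :
    ∑ x, p x = ∑ i, ∑ j, p (finProdFinEquiv (i, j)) := by
  rw [← finProdFinEquiv.sum_comp, Fintype.sum_prod_type]

/-- An entrywise splitting of a table is a pair of tables; their row and column sums form splittings
of `α` and `β`, and these are the outer indices on the right. -/
theorem sum_tables_splittings {k l : ℕ} (α : Fin k → ℕ) (β : Fin l → ℕ)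
    (G : (Fin (k * l) → ℕ) → (Fin (k * l) → ℕ) → M) :
    ∑ γ ∈ tables α β, ∑ p ∈ splittings (flatten γ), G p.1 p.2 =
      ∑ a ∈ splittings α, ∑ b ∈ splittings β, ∑ γ ∈ tables a.1 b.1, ∑ δ ∈ tables a.2 b.2,
        G (flatten γ) (flatten δ) := by
  simp_rw [Finset.sum_sigma']
  refine Finset.sum_nbij'
    (fun x => ⟨(fun i => ∑ j, x.2.1 (finProdFinEquiv (i, j)),
        fun i => ∑ j, x.2.2 (finProdFinEquiv (i, j))),
      (fun j => ∑ i, x.2.1 (finProdFinEquiv (i, j)),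
        fun j => ∑ i, x.2.2 (finProdFinEquiv (i, j))),
      fun i j => x.2.1 (finProdFinEquiv (i, j)), fun i j => x.2.2 (finProdFinEquiv (i, j))⟩)
    (fun x => ⟨x.2.2.1 + x.2.2.2, (flatten x.2.2.1, flatten x.2.2.2)⟩) ?_ ?_ ?_ ?_ ?_
  · rintro ⟨γ, p, q⟩ h
    simp only [Finset.mem_sigma, mem_splittings, mem_tables] at h ⊢
    have hpq : ∀ i j, p (finProdFinEquiv (i, j)) + q (finProdFinEquiv (i, j)) = γ i j :=
      fun i j => by rw [← flatten_apply γ, ← h.2, Pi.add_apply]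
    refine ⟨?_, ?_, by simp, by simp⟩
    · ext i
      simp [← Finset.sum_add_distrib, hpq, h.1.1]
    · ext j
      simp [← Finset.sum_add_distrib, hpq, h.1.2]
  · rintro ⟨⟨a, b⟩, ⟨c, d⟩, γ, δ⟩ h
    simp only [Finset.mem_sigma, mem_splittings, mem_tables] at h ⊢
    obtain ⟨rfl, rfl, h1, h2⟩ := h
    exact ⟨by simp [Finset.sum_add_distrib, h1, h2], rfl⟩
  · rintro ⟨γ, p, q⟩ h
    simp only [Finset.mem_sigma, mem_splittings, mem_tables] at h
    have hf : ∀ r : Fin (k * l) → ℕ, flatten (fun i j => r (finProdFinEquiv (i, j))) = r :=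
      fun r => funext fun x => congrArg r (finProdFinEquiv.apply_symm_apply x)
    have hγ : (fun i j => p (finProdFinEquiv (i, j))) + (fun i j => q (finProdFinEquiv (i, j))) =
        γ := by
      ext i j
      simp only [← flatten_apply γ, ← h.2, Pi.add_apply]
    simp only [hf, hγ]
  · rintro ⟨⟨a, b⟩, ⟨c, d⟩, γ, δ⟩ h
    simp only [Finset.mem_sigma, mem_splittings, mem_tables] at h
    obtain ⟨-, -, h1, h2⟩ := h
    simp only [flatten_apply, h1, h2]
  · rintro ⟨γ, p, q⟩ h
    have hf : ∀ r : Fin (k * l) → ℕ, flatten (fun i j => r (finProdFinEquiv (i, j))) = r :=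
      fun r => funext fun x => congrArg r (finProdFinEquiv.apply_symm_apply x)
    simp only [hf]

/-- Both sides run over arrays indexed by `(i, j, c)` with plane sums `α`, `β`, `ζ`. The array
determines the intermediate table: `γ` is its marginal over `c` on the left and over `i` on the
right. -/
theorem sum_tables_assoc {k l m : ℕ} (α : Fin k → ℕ) (β : Fin l → ℕ) (ζ : Fin m → ℕ)
    {G : (Fin k → Fin l → ℕ) → (Fin (k * l) → Fin m → ℕ) → M}
    {G' : (Fin l → Fin m → ℕ) → (Fin k → Fin (l * m) → ℕ) → M}
    (hG : ∀ γ δ γ' δ', (∀ i j c, δ (finProdFinEquiv (i, j)) c = δ' i (finProdFinEquiv (j, c))) →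
      G γ δ = G' γ' δ') :
    ∑ γ ∈ tables α β, ∑ δ ∈ tables (flatten γ) ζ, G γ δ =
      ∑ γ ∈ tables β ζ, ∑ δ ∈ tables α (flatten γ), G' γ δ := by
  simp_rw [Finset.sum_sigma']
  refine Finset.sum_nbij'
    (fun x => ⟨fun j c => ∑ i, x.2 (finProdFinEquiv (i, j)) c,
      fun i q => x.2 (finProdFinEquiv (i, (finProdFinEquiv.symm q).1)) (finProdFinEquiv.symm q).2⟩)
    (fun x => ⟨fun i j => ∑ c, x.2 i (finProdFinEquiv (j, c)),
      fun q c => x.2 (finProdFinEquiv.symm q).1 (finProdFinEquiv ((finProdFinEquiv.symm q).2, c))⟩)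
    ?_ ?_ ?_ ?_ ?_
  · rintro ⟨γ, δ⟩ h
    simp only [Finset.mem_sigma, mem_tables] at h ⊢
    obtain ⟨⟨h1, h2⟩, h3, h4⟩ := h
    simp only [finProdFinEquiv.surjective.forall, Prod.forall, flatten_apply] at h3
    simp only [sum_fin_mul] at h4
    simp only [finProdFinEquiv.surjective.forall, Prod.forall, flatten_apply, sum_fin_mul,
      Equiv.symm_apply_apply]
    refine ⟨⟨fun j => ?_, fun c => ?_⟩, fun i => ?_, fun _ _ => trivial⟩
    · rw [Finset.sum_comm]
      simp only [h3, h2]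
    · rw [Finset.sum_comm, h4]
    · simp only [h3, h1]
  · rintro ⟨γ, δ⟩ h
    simp only [Finset.mem_sigma, mem_tables] at h ⊢
    obtain ⟨⟨h1, h2⟩, h3, h4⟩ := h
    simp only [finProdFinEquiv.surjective.forall, Prod.forall, flatten_apply] at h4
    simp only [sum_fin_mul] at h3
    simp only [finProdFinEquiv.surjective.forall, Prod.forall, flatten_apply, sum_fin_mul,
      Equiv.symm_apply_apply]
    refine ⟨⟨fun i => ?_, fun j => ?_⟩, fun _ _ => trivial, fun c => ?_⟩
    · rw [h3]
    · rw [Finset.sum_comm]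
      simp only [h4, h1]
    · rw [Finset.sum_comm]
      simp only [h4, h2]
  · rintro ⟨γ, δ⟩ h
    simp only [Finset.mem_sigma, mem_tables] at h
    obtain ⟨-, h3, -⟩ := h
    simp only [Equiv.symm_apply_apply, h3, flatten_apply, Prod.mk.eta, Equiv.apply_symm_apply]
  · rintro ⟨γ, δ⟩ h
    simp only [Finset.mem_sigma, mem_tables] at h
    obtain ⟨-, -, h4⟩ := h
    simp only [Equiv.symm_apply_apply, h4, flatten_apply, Prod.mk.eta, Equiv.apply_symm_apply]
  · rintro ⟨γ, δ⟩ -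
    exact hG _ _ _ _ fun i j c => by simp only [Equiv.symm_apply_apply]

end Sums

end WeakMopiscotion

/-! ### Algebra and coalgebra axioms for the external structure -/

namespace PNSym

open WeakMopiscotion

variable (k : Type u) [CommRing k]

theorem F_hom_ext {k : Type u} [CommRing k] {M : Type*} [AddCommMonoid M] [Module k M]
    {f g : PNSym k →ₗ[k] M} (h : ∀ w, f (F k w) = g (F k w)) : f = g :=
  (basis k).ext fun a => by rw [← F_mopiscotion, h]

theorem F_induction {k : Type u} [CommRing k] {p : PNSym k → Prop} (f : PNSym k)
    (hF : ∀ w, p (F k w)) (add : ∀ f g, p f → p g → p (f + g))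
    (smul : ∀ (c : k) f, p f → p (c • f)) : p f := by
  have hf : f ∈ Submodule.span k (Set.range (basis k)) := by
    rw [(basis k).span_eq]
    trivial
  induction hf using Submodule.span_induction with
  | mem x hx =>
    obtain ⟨a, rfl⟩ := hx
    exact hF a.1 |> (F_mopiscotion k a ▸ ·)
  -- Zero needs no case of its own, being `0 • F nil`.
  | zero => simpa using smul 0 _ (hF nil)
  | add x y _ _ hx hy => exact add x y hx hy
  | smul c x _ hx => exact smul c x hx

theorem one_eq : one k = F k nil :=
  (F_mopiscotion k Mopiscotion.empty).symm

/-- The empty pattern embeds in every `w` and here misses only zero parts. -/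
theorem F_of_parts_eq_zero {w : WeakMopiscotion} (hw : w.parts = 0) : F k w = one k := by
  rw [one_eq]
  have hp : IsPattern nil.perm w.perm Fin.elim0 :=
    ⟨fun i => i.elim0, fun i => i.elim0⟩
  rw [← F_comp k hp (p := w.parts) fun j _ => congrFun hw j]
  exact congrArg (F k) (ext_cast rfl (fun i => i.elim0) fun i => i.elim0)

theorem extMul_assoc (f g h : PNSym k) :
    extMul k (extMul k f g) h = extMul k f (extMul k g h) := by
  induction f using F_induction with
  | add f f' hf hf' => simp [hf, hf']
  | smul c f hf => simp [hf]
  | hF u =>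
    induction g using F_induction with
    | add g g' hg hg' => simp [hg, hg']
    | smul c g hg => simp [hg]
    | hF v =>
      induction h using F_induction with
      | add h h' hh hh' => simp [hh, hh']
      | smul c h hh => simp [hh]
      | hF w => simp only [extMul_F, concat_assoc]

theorem intMul_assoc (f g h : PNSym k) :
    intMul k (intMul k f g) h = intMul k f (intMul k g h) := by
  induction f using F_induction with
  | add f f' hf hf' => simp [hf, hf']
  | smul c f hf => simp [hf]
  | hF u =>
    induction g using F_induction with
    | add g g' hg hg' => simp [hg, hg']
    | smul c g hg => simp [hg]
    | hF v =>
      induction h using F_induction with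
      | add h h' hh hh' => simp [hh, hh']
      | smul c h hh => simp [hh]
      | hF w =>
        simp only [intMul_F, map_sum, LinearMap.sum_apply]
        exact sum_tables_assoc u.parts v.parts w.parts fun γ δ γ' δ' h =>
          congrArg (F k) (ofTable_assoc u v w h)

theorem one_extMul (f : PNSym k) : extMul k (one k) f = f := by
  induction f using F_induction with
  | add f f' hf hf' => simp [hf, hf']
  | smul c f hf => simp [hf]
  | hF w => rw [one_eq, extMul_F, nil_concat]

theorem extMul_one (f : PNSym k) : extMul k f (one k) = f := by
  induction f using F_induction with
  | add f f' hf hf' => simp [hf, hf']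
  | smul c f hf => simp [hf]
  | hF w => rw [one_eq, extMul_F, concat_nil]

theorem counit_one : counit k (one k) = 1 := by
  rw [one_eq, counit_F, if_pos]
  exact funext fun i => i.elim0

theorem counit_extMul (f g : PNSym k) :
    counit k (extMul k f g) = counit k f * counit k g := by
  induction f using F_induction with
  | add f f' hf hf' => simp [hf, hf', add_mul]
  | smul c f hf => simp [hf, mul_assoc]
  | hF v =>
    induction g using F_induction with
    | add g g' hg hg' => simp [hg, hg', mul_add]
    | smul c g hg => simp only [map_smul, hg, smul_eq_mul]; ring
    | hF w =>
      rw [extMul_F, counit_F, counit_F, counit_F, ite_zero_mul_ite_zero, mul_one]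
      refine if_congr ⟨fun h => ⟨?_, ?_⟩, fun h => ?_⟩ rfl rfl
      · ext i
        exact (Fin.append_left v.parts w.parts i).symm.trans (congrFun h (Fin.castAdd w.len i))
      · ext i
        exact (Fin.append_right v.parts w.parts i).symm.trans (congrFun h (Fin.natAdd v.len i))
      · change Fin.append v.parts w.parts = fun _ => 0
        ext i
        cases i using Fin.addCases <;> simp [h.1, h.2]

/-- Only the zero table contributes, and it is admissible exactly when all row and column sums are
zero. -/
theorem counit_intMul (f g : PNSym k) :
    counit k (intMul k f g) = counit k f * counit k g := by
  induction f using F_induction with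
  | add f f' hf hf' => simp [hf, hf', add_mul]
  | smul c f hf => simp [hf, mul_assoc]
  | hF v =>
    induction g using F_induction with
    | add g g' hg hg' => simp [hg, hg', mul_add]
    | smul c g hg => simp only [map_smul, hg, smul_eq_mul]; ring
    | hF w =>
      have key : ∀ γ, (v.ofTable w γ).parts = 0 ↔ γ = 0 := fun γ => by
        refine ⟨fun h => ?_, fun h => ?_⟩
        · ext i j
          rw [← flatten_apply γ]
          exact congrFun h _
        · subst h
          rfl
      have key' : (0 : Fin v.len → Fin w.len → ℕ) ∈ tables v.parts w.parts ↔
          v.parts = 0 ∧ w.parts = 0 := by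
        simp [mem_tables, funext_iff, eq_comm]
      simp only [intMul_F, map_sum, counit_F, key, Finset.sum_ite_eq', key']
      rw [ite_zero_mul_ite_zero, mul_one]

theorem comul_coassoc : TensorProduct.assoc k (PNSym k) (PNSym k) (PNSym k) ∘ₗ
    (comul k).rTensor (PNSym k) ∘ₗ comul k = (comul k).lTensor (PNSym k) ∘ₗ comul k := by
  refine F_hom_ext fun w => ?_
  simp only [LinearMap.comp_apply, comul_F, map_sum, LinearMap.rTensor_tmul,
    LinearMap.lTensor_tmul, TensorProduct.sum_tmul, TensorProduct.tmul_sum,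
    LinearEquiv.coe_coe, TensorProduct.assoc_tmul]
  exact sum_splittings_assoc w.parts fun a b c =>
    F k ⟨w.len, a, w.perm⟩ ⊗ₜ[k] (F k ⟨w.len, b, w.perm⟩ ⊗ₜ[k] F k ⟨w.len, c, w.perm⟩)

theorem comul_comm :
    (TensorProduct.comm k (PNSym k) (PNSym k)).toLinearMap ∘ₗ comul k = comul k := by
  refine F_hom_ext fun w => ?_
  simp only [LinearMap.comp_apply, comul_F, map_sum, LinearEquiv.coe_coe,
    TensorProduct.comm_tmul]
  exact sum_splittings_comm w.parts fun a b =>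
    F k ⟨w.len, b, w.perm⟩ ⊗ₜ[k] F k ⟨w.len, a, w.perm⟩

theorem rTensor_counit_comp_comul :
    (counit k).rTensor (PNSym k) ∘ₗ comul k = TensorProduct.mk k k (PNSym k) 1 := by
  refine F_hom_ext fun w => ?_
  simp only [LinearMap.comp_apply, comul_F, map_sum, LinearMap.rTensor_tmul, counit_F]
  -- The counit kills every term whose left part is nonzero.
  rw [Finset.sum_eq_single (0, w.parts)]
  · simp
  · rintro ⟨a, b⟩ h hne
    rw [mem_splittings] at h
    rw [if_neg, TensorProduct.zero_tmul]
    intro h0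
    exact hne (by rw [← h, show a = 0 from h0, zero_add])
  · intro h
    simp [mem_splittings] at h

theorem lTensor_counit_comp_comul :
    (counit k).lTensor (PNSym k) ∘ₗ comul k = (TensorProduct.mk k (PNSym k) k).flip 1 := by
  refine F_hom_ext fun w => ?_
  simp only [LinearMap.comp_apply, comul_F, map_sum, LinearMap.lTensor_tmul, counit_F]
  rw [Finset.sum_eq_single (w.parts, 0)]
  · simp
  · rintro ⟨a, b⟩ h hne
    rw [mem_splittings] at h
    rw [if_neg, TensorProduct.tmul_zero]
    intro h0
    exact hne (by rw [← h, show b = 0 from h0, add_zero])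
  · intro h
    simp [mem_splittings] at h

noncomputable instance : Coalgebra k (PNSym k) where
  comul := comul k
  counit := counit k
  coassoc := comul_coassoc k
  rTensor_counit_comp_comul := rTensor_counit_comp_comul k
  lTensor_counit_comp_comul := lTensor_counit_comp_comul k

instance : Coalgebra.IsCocomm k (PNSym k) := ⟨comul_comm k⟩

noncomputable scoped instance : Ring (PNSym k) where
  __ := (inferInstance : AddCommGroup (PNSym k))
  mul f g := extMul k f g
  one := one k
  mul_assoc := extMul_assoc k
  one_mul := one_extMul k
  mul_one := extMul_one k
  left_distrib f := map_add (extMul k f)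
  right_distrib f g h := by
    change extMul k (f + g) h = extMul k f h + extMul k g h
    simp
  zero_mul f := by
    change extMul k 0 f = 0
    simp
  mul_zero f := map_zero (extMul k f)

theorem mul_def (f g : PNSym k) : f * g = extMul k f g := rfl

theorem one_def : (1 : PNSym k) = one k := rfl

noncomputable scoped instance : Algebra k (PNSym k) :=
  Algebra.ofModule (fun c f g => by simp [mul_def]) fun c f g => by simp [mul_def]

theorem comul_mul (f g : PNSym k) :
    comul k (f * g) = (comul k f * comul k g : PNSym k ⊗[k] PNSym k) := by
  induction f using F_induction with
  | add f f' hf hf' => simp [add_mul, hf, hf']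
  | smul c f hf =>
    rw [smul_mul_assoc, map_smul, map_smul, hf]
    exact (smul_mul_assoc c (comul k f) (comul k g)).symm
  | hF v =>
    induction g using F_induction with
    | add g g' hg hg' => simp [mul_add, hg, hg']
    | smul c g hg =>
      rw [mul_smul_comm, map_smul, map_smul, hg]
      exact (mul_smul_comm c (comul k (F k v)) (comul k g)).symm
    | hF w =>
      simp only [mul_def, extMul_F, comul_F, Finset.sum_mul_sum,
        Algebra.TensorProduct.tmul_mul_tmul]
      exact sum_splittings_append v.parts w.parts fun a b =>
        F k ⟨_, a, (v.concat w).perm⟩ ⊗ₜ[k] F k ⟨_, b, (v.concat w).perm⟩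

noncomputable scoped instance : Bialgebra k (PNSym k) :=
  Bialgebra.mk' k (PNSym k) (counit_one k) (fun {f g} => counit_extMul k f g)
    (by
      change comul k (one k) = 1
      rw [one_eq, comul_F, Finset.sum_eq_single (0, 0)]
      · rw [F_of_parts_eq_zero k rfl]
        rfl
      · exact fun p _ hp => absurd (Prod.ext (funext fun i => i.elim0) (funext fun i => i.elim0)) hp
      · exact fun h => absurd (mem_splittings.mpr (funext fun i => i.elim0)) h)
    fun {f g} => comul_mul k f g

end PNSym

/-! ### The internal bialgebra, on a separate type carrying the other product -/

/-- The module `PNSym` with the internal multiplication. -/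
def InternalPNSym (k : Type u) [CommRing k] : Type u := PNSym k

namespace InternalPNSym

open WeakMopiscotion PNSym

variable (k : Type u) [CommRing k]

noncomputable instance : AddCommGroup (InternalPNSym k) :=
  inferInstanceAs (AddCommGroup (PNSym k))

noncomputable instance : NonUnitalRing (InternalPNSym k) where
  __ := (inferInstance : AddCommGroup (InternalPNSym k))
  mul f g := intMul k f g
  mul_assoc := intMul_assoc k
  left_distrib f := map_add (intMul k f)
  right_distrib f g h := LinearMap.congr_fun (map_add (intMul k) f g) h
  zero_mul f := LinearMap.congr_fun (map_zero (intMul k)) f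
  mul_zero f := map_zero (intMul k f)

noncomputable instance : Module k (InternalPNSym k) := inferInstanceAs (Module k (PNSym k))

/-- The identity map from `PNSym` to `InternalPNSym`. -/
noncomputable def of : PNSym k ≃ₗ[k] InternalPNSym k := LinearEquiv.refl k (PNSym k)

theorem of_mul (f g : PNSym k) : of k f * of k g = of k (intMul k f g) := rfl

instance : IsScalarTower k (InternalPNSym k) (InternalPNSym k) :=
  ⟨fun c f g => LinearMap.congr_fun (map_smul (intMul k) c f) g⟩

instance : SMulCommClass k (InternalPNSym k) (InternalPNSym k) :=
  ⟨fun c f g => (map_smul (intMul k f) c g).symm⟩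

noncomputable instance : Coalgebra k (InternalPNSym k) :=
  inferInstanceAs (Coalgebra k (PNSym k))

theorem comul_of (f : PNSym k) : Coalgebra.comul (R := k) (of k f) =
    TensorProduct.map (of k).toLinearMap (of k).toLinearMap (comul k f) :=
  (LinearMap.congr_fun (TensorProduct.map_id (R := k) (M := PNSym k) (N := PNSym k))
    (comul k f)).symm

theorem comul_of_intMul (f g : PNSym k) : Coalgebra.comul (R := k) (of k (intMul k f g)) =
    Coalgebra.comul (R := k) (of k f) * Coalgebra.comul (R := k) (of k g) := by
  induction f using F_induction with
  | add f f' hf hf' => simp only [map_add, LinearMap.add_apply, hf, hf', add_mul]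
  | smul c f hf => simp only [map_smul, LinearMap.smul_apply, hf, smul_mul_assoc]
  | hF v =>
    induction g using F_induction with
    | add g g' hg hg' => simp only [map_add, hg, hg', mul_add]
    | smul c g hg => simp only [map_smul, hg, mul_smul_comm]
    | hF w =>
      simp only [comul_of, intMul_F, map_sum, comul_F, Finset.sum_mul_sum,
        TensorProduct.map_tmul, Algebra.TensorProduct.tmul_mul_tmul, LinearEquiv.coe_coe, of_mul,
        TensorProduct.sum_tmul, TensorProduct.tmul_sum]
      refine (sum_tables_splittings v.parts w.parts fun a b =>
        of k (F k ⟨v.len * w.len, a, bracket w.perm v.perm⟩) ⊗ₜ[k]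
          of k (F k ⟨v.len * w.len, b, bracket w.perm v.perm⟩)).trans ?_
      refine Finset.sum_congr rfl fun a _ => Finset.sum_congr rfl fun b _ => ?_
      -- Expanding the tensor product of the two table sums puts them in the opposite order.
      exact Finset.sum_comm

noncomputable instance : NonUnitalBialgebra k (InternalPNSym k) where
  comul_mul f g := comul_of_intMul k f g
  counit_mul f g := counit_intMul k f g

end InternalPNSym

/-! ### Size and the grading -/

namespace WeakMopiscotion

theorem size_red (w : WeakMopiscotion) : w.red.1.size = w.size := by
  obtain ⟨f, hf, hp, hz⟩ := w.exists_isPattern_red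
  rw [size, hp]
  exact sum_comp_of_injective hf.strictMono.injective hz

theorem size_concat (v w : WeakMopiscotion) : (v.concat w).size = v.size + w.size := by
  refine (Fin.sum_univ_add (Fin.append v.parts w.parts)).trans ?_
  simp [size]

theorem size_add_size {w : WeakMopiscotion} {p : (Fin w.len → ℕ) × (Fin w.len → ℕ)}
    (hp : p ∈ splittings w.parts) :
    size ⟨w.len, p.1, w.perm⟩ + size ⟨w.len, p.2, w.perm⟩ = w.size := by
  rw [mem_splittings] at hp
  simp [size, ← hp, Finset.sum_add_distrib]

theorem size_eq_zero_iff {w : WeakMopiscotion} : w.size = 0 ↔ w.parts = 0 := by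
  simp [size, funext_iff]

end WeakMopiscotion

namespace PNSym

open WeakMopiscotion

variable (k : Type u) [CommRing k]

section Grading

theorem F_mem_grade {w : WeakMopiscotion} {n : ℕ} (h : w.size = n) : F k w ∈ grade k n :=
  Submodule.subset_span ⟨w.red, (size_red w).trans h, rfl⟩

theorem grade_induction {k : Type u} [CommRing k] {n : ℕ} {p : (f : PNSym k) → f ∈ grade k n → Prop}
    (hF : ∀ w (hw : w.size = n), p (F k w) (F_mem_grade k hw)) (zero : p 0 (zero_mem _))
    (add : ∀ f g hf hg, p f hf → p g hg → p (f + g) (add_mem hf hg))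
    (smul : ∀ (c : k) f hf, p f hf → p (c • f) (Submodule.smul_mem _ c hf)) {f : PNSym k}
    (hf : f ∈ grade k n) : p f hf := by
  induction hf using Submodule.span_induction with
  | mem x hx =>
    obtain ⟨a, ha, rfl⟩ := hx
    simpa only [F_mopiscotion] using hF a.1 ha
  | zero => exact zero
  | add x y _ _ hx hy => exact add x y _ _ hx hy
  | smul c x _ hx => exact smul c x _ hx

theorem extMul_mem_grade {m n : ℕ} {f g : PNSym k} (hf : f ∈ grade k m) (hg : g ∈ grade k n) :
    extMul k f g ∈ grade k (m + n) := by
  induction hf using grade_induction with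
  | zero => simp
  | add f f' _ _ hf hf' => simpa using add_mem hf hf'
  | smul c f _ hf => simpa using Submodule.smul_mem _ c hf
  | hF v hv =>
    induction hg using grade_induction with
    | zero => simp
    | add g g' _ _ hg hg' => simpa using add_mem hg hg'
    | smul c g _ hg => simpa using Submodule.smul_mem _ c hg
    | hF w hw =>
      rw [extMul_F]
      exact F_mem_grade k (by rw [size_concat, hv, hw])

theorem comul_mem_grade {n : ℕ} {f : PNSym k} (hf : f ∈ grade k n) :
    comul k f ∈ ⨆ p ∈ Finset.HasAntidiagonal.antidiagonal n,
      Submodule.map₂ (TensorProduct.mk k (PNSym k) (PNSym k)) (grade k p.1) (grade k p.2) := by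
  induction hf using grade_induction with
  | zero => simp
  | add f f' _ _ hf hf' => simpa using add_mem hf hf'
  | smul c f _ hf => simpa using Submodule.smul_mem _ c hf
  | hF w hw =>
    rw [comul_F]
    refine Submodule.sum_mem _ fun p hp => ?_
    have hmem : (size ⟨w.len, p.1, w.perm⟩, size ⟨w.len, p.2, w.perm⟩) ∈
        Finset.HasAntidiagonal.antidiagonal n := by
      rw [Finset.HasAntidiagonal.mem_antidiagonal, ← hw]
      exact size_add_size hp
    exact Submodule.mem_iSup_of_mem _ (Submodule.mem_iSup_of_mem hmem
      (Submodule.apply_mem_map₂ _ (F_mem_grade k rfl) (F_mem_grade k rfl)))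

theorem counit_eq_zero_of_mem_grade {n : ℕ} (hn : n ≠ 0) {f : PNSym k} (hf : f ∈ grade k n) :
    counit k f = 0 := by
  induction hf using grade_induction with
  | zero => simp
  | add f f' _ _ hf hf' => simp [hf, hf']
  | smul c f _ hf => simp [hf]
  | hF w hw =>
    rw [counit_F, if_neg]
    rwa [← size_eq_zero_iff, hw]

theorem grade_zero : grade k 0 = Submodule.span k {one k} := by
  refine le_antisymm (fun f hf => ?_) ?_
  · induction hf using grade_induction with
    | zero => exact zero_mem _
    | add f f' _ _ hf hf' => exact add_mem hf hf'
    | smul c f _ hf => exact Submodule.smul_mem _ c hf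
    | hF w hw =>
      rw [F_of_parts_eq_zero k (size_eq_zero_iff.mp hw)]
      exact Submodule.mem_span_singleton_self _
  · rw [Submodule.span_singleton_le_iff_mem, one_eq]
    exact F_mem_grade k (by simp [size, nil])

scoped instance : SetLike.GradedMonoid (grade k) where
  one_mem := by
    rw [grade_zero]
    exact Submodule.mem_span_singleton_self _
  mul_mem _ _ _ _ hf hg := extMul_mem_grade k hf hg

/-- The linear map sending an element to the family of its homogeneous components. -/
noncomputable def decompose : PNSym k →ₗ[k] DirectSum ℕ fun n => grade k n :=
  (basis k).constr k fun a =>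
    DirectSum.lof k ℕ (fun n => grade k n) a.1.size ⟨basis k a, Submodule.subset_span ⟨a, rfl, rfl⟩⟩

/-- Keeping the degree as a variable `n` avoids transport between components of propositionally
equal degree. -/
theorem decompose_basis {n : ℕ} (a : Mopiscotion) (ha : a.1.size = n) :
    decompose k (basis k a) = DirectSum.lof k ℕ (fun n => grade k n) n
      ⟨basis k a, Submodule.subset_span ⟨a, ha, rfl⟩⟩ := by
  subst ha
  simp [decompose]

theorem decompose_of_mem {n : ℕ} {f : PNSym k} (hf : f ∈ grade k n) :
    decompose k f = DirectSum.lof k ℕ (fun n => grade k n) n ⟨f, hf⟩ := by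
  induction hf using Submodule.span_induction with
  | mem x hx =>
    obtain ⟨a, ha, rfl⟩ := hx
    exact decompose_basis k a ha
  | zero => exact (map_zero _).trans (map_zero _).symm
  | add x y _ _ hx hy =>
    rw [map_add, hx, hy, ← map_add]
    rfl
  | smul c x _ hx =>
    rw [map_smul, hx, ← map_smul]
    rfl

noncomputable scoped instance : DirectSum.Decomposition (grade k) :=
  DirectSum.Decomposition.ofLinearMap _ (decompose k)
    ((basis k).ext fun a => by
      rw [LinearMap.comp_apply, decompose_basis k a rfl, DirectSum.coeLinearMap_lof]
      rfl)
    (by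
      ext n f : 2
      rw [LinearMap.comp_apply, LinearMap.comp_apply, DirectSum.coeLinearMap_lof,
        decompose_of_mem k f.2]
      rfl)

noncomputable scoped instance : GradedAlgebra (grade k) where

end Grading

/-! ### The antipode by a convolution geometric series -/

section Antipode

open WithConv

/-- The difference of the unit of the convolution algebra of `PNSym` and the identity map. -/
noncomputable def oneSubId : WithConv (PNSym k →ₗ[k] PNSym k) := 1 - toConv LinearMap.id

theorem convMul_F (f g : WithConv (PNSym k →ₗ[k] PNSym k)) (w : WeakMopiscotion) :
    (f * g) (F k w) = ∑ p ∈ splittings w.parts,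
      f (F k ⟨w.len, p.1, w.perm⟩) * g (F k ⟨w.len, p.2, w.perm⟩) := by
  rw [LinearMap.convMul_apply]
  change LinearMap.mul' k (PNSym k) (TensorProduct.map f.ofConv g.ofConv (comul k (F k w))) = _
  rw [comul_F, map_sum, map_sum]
  rfl

theorem oneSubId_F {w : WeakMopiscotion} (hw : w.parts = 0) : oneSubId k (F k w) = 0 := by
  have h : oneSubId k (F k w) =
    algebraMap k (PNSym k) (counit k (F k w)) - F k w := rfl
  rw [h, F_of_parts_eq_zero k hw, counit_one, map_one, one_def, sub_self]

/-- Each convolution factor must absorb a part of positive size, since `oneSubId` vanishes in degree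
`0`; more factors than the size allows give zero. -/
theorem oneSubId_pow_F {m : ℕ} {w : WeakMopiscotion} (hw : w.size < m) :
    (oneSubId k ^ m) (F k w) = 0 := by
  induction m generalizing w with
  | zero => exact absurd hw (Nat.not_lt_zero _)
  | succ m ih =>
    rw [pow_succ', convMul_F]
    refine Finset.sum_eq_zero fun p hp => ?_
    have hs := size_add_size hp
    by_cases h : p.1 = 0
    · rw [oneSubId_F k h, zero_mul]
    · have h' : size ⟨w.len, p.1, w.perm⟩ ≠ 0 := fun h0 => h (size_eq_zero_iff.mp h0)
      rw [ih (by omega), mul_zero]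

/-- The antipode of `PNSym`, given by Takeuchi's formula. -/
noncomputable def antipode : PNSym k →ₗ[k] PNSym k :=
  (basis k).constr k fun a => ∑ m ∈ Finset.range (a.1.size + 1), (oneSubId k ^ m) (basis k a)

theorem sum_conv_apply {ι : Type*} (s : Finset ι) (g : ι → WithConv (PNSym k →ₗ[k] PNSym k))
    (f : PNSym k) : (∑ i ∈ s, g i) f = ∑ i ∈ s, g i f := by
  induction s using Finset.cons_induction with
  | empty => rfl
  | cons a s ha ih =>
    rw [Finset.sum_cons, Finset.sum_cons, ← ih]
    rfl

/-- Terms beyond the size vanish, so any larger cutoff gives the same value. One cutoff thus serves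
all terms of a coproduct. -/
theorem antipode_F {w : WeakMopiscotion} {n : ℕ} (hw : w.size ≤ n) :
    antipode k (F k w) = (∑ m ∈ Finset.range (n + 1), oneSubId k ^ m) (F k w) := by
  have h : antipode k (F k w) =
      ∑ m ∈ Finset.range (w.red.1.size + 1), (oneSubId k ^ m) (F k w) := by
    simp [antipode, F]
  rw [h, size_red, sum_conv_apply]
  refine Finset.sum_subset (Finset.range_mono (by omega)) fun m _ hm => oneSubId_pow_F k ?_
  simpa [Nat.lt_succ_iff] using hm

theorem one_sub_oneSubId : 1 - oneSubId k = toConv LinearMap.id := sub_sub_cancel _ _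

theorem sub_oneSubId_pow_F (w : WeakMopiscotion) :
    (1 - oneSubId k ^ (w.size + 1)) (F k w) = algebraMap k (PNSym k) (counit k (F k w)) := by
  have h : (1 - oneSubId k ^ (w.size + 1)) (F k w) =
    algebraMap k (PNSym k) (counit k (F k w)) - (oneSubId k ^ (w.size + 1)) (F k w) := rfl
  rw [h, oneSubId_pow_F k (Nat.lt_succ_self _), sub_zero]

noncomputable scoped instance : HopfAlgebra k (PNSym k) where
  antipode := antipode k
  mul_antipode_rTensor_comul := by
    refine F_hom_ext fun w => ?_
    refine Eq.trans ?_ (sub_oneSubId_pow_F k w)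
    -- Telescoping writes `1 - e ^ (N + 1)` as the truncated series times `1 - e = id`, where `e` is
    -- `oneSubId` and `N` the size of `w`; on each left part the series agrees with the antipode.
    rw [← geom_sum_mul_neg, one_sub_oneSubId]
    refine (convMul_F k (toConv (antipode k)) (toConv LinearMap.id) w).trans ?_
    rw [convMul_F]
    refine Finset.sum_congr rfl fun p hp => congrArg (· * _) (antipode_F k ?_)
    rw [← size_add_size hp]
    exact Nat.le_add_right _ _
  mul_antipode_lTensor_comul := by
    refine F_hom_ext fun w => ?_
    refine Eq.trans ?_ (sub_oneSubId_pow_F k w)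
    rw [← mul_neg_geom_sum, one_sub_oneSubId]
    refine (convMul_F k (toConv LinearMap.id) (toConv (antipode k)) w).trans ?_
    rw [convMul_F]
    refine Finset.sum_congr rfl fun p hp => congrArg (_ * ·) (antipode_F k ?_)
    rw [← size_add_size hp]
    exact Nat.le_add_left _ _

end Antipode

end PNSym

/-! ### Assembly of both structures -/

theorem mainTheorem2 (k : Type u) [CommRing k] :
    -- with the external multiplication, `PNSym` is a connected graded cocommutative Hopf algebra
    (∃ (H : Type u) (_ : Ring H) (_ : HopfAlgebra k H) (e : PNSym k ≃ₗ[k] H),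
      (∀ f g, e (PNSym.extMul k f g) = e f * e g) ∧
      e (PNSym.one k) = 1 ∧
      (∀ f, Coalgebra.comul (R := k) (e f) =
        TensorProduct.map e.toLinearMap e.toLinearMap (PNSym.comul k f)) ∧
      (∀ f, Coalgebra.counit (R := k) (e f) = PNSym.counit k f) ∧
      Coalgebra.IsCocomm k H ∧
      -- graded: algebra and coalgebra structure respect the grading
      Nonempty (GradedAlgebra fun n => (PNSym.grade k n).map e.toLinearMap) ∧
      (∀ n, ∀ f ∈ PNSym.grade k n, PNSym.comul k f ∈
        ⨆ p ∈ Finset.HasAntidiagonal.antidiagonal n, Submodule.map₂ (TensorProduct.mk k (PNSym k) (PNSym k))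
          (PNSym.grade k p.1) (PNSym.grade k p.2)) ∧
      (∀ n, n ≠ 0 → ∀ f ∈ PNSym.grade k n, PNSym.counit k f = 0) ∧
      -- connected
      PNSym.grade k 0 = Submodule.span k {PNSym.one k}) ∧
    -- with the internal multiplication, `PNSym` is a non-unital bialgebra
    (∃ (B : Type u) (_ : NonUnitalRing B) (_ : Module k B) (_ : IsScalarTower k B B)
        (_ : SMulCommClass k B B) (_ : NonUnitalBialgebra k B) (e : PNSym k ≃ₗ[k] B),
      (∀ f g, e (PNSym.intMul k f g) = e f * e g) ∧
      (∀ f, Coalgebra.comul (R := k) (e f) =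
        TensorProduct.map e.toLinearMap e.toLinearMap (PNSym.comul k f)) ∧
      (∀ f, Coalgebra.counit (R := k) (e f) = PNSym.counit k f)) ∧
    -- in particular, both multiplications are associative
    (∀ f g h, PNSym.extMul k (PNSym.extMul k f g) h = PNSym.extMul k f (PNSym.extMul k g h)) ∧
    (∀ f g h, PNSym.intMul k (PNSym.intMul k f g) h =
      PNSym.intMul k f (PNSym.intMul k g h)) := by
  open PNSym in
  refine ⟨⟨PNSym k, inferInstance, inferInstance, LinearEquiv.refl k (PNSym k), fun _ _ => rfl, rfl,
      fun f => ?_, fun _ => rfl, inferInstance, ?_, fun _ _ => PNSym.comul_mem_grade k,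
      fun _ hn _ => PNSym.counit_eq_zero_of_mem_grade k hn, PNSym.grade_zero k⟩,
    ⟨InternalPNSym k, inferInstance, inferInstance, inferInstance, inferInstance, inferInstance,
      InternalPNSym.of k, fun _ _ => rfl, InternalPNSym.comul_of k, fun _ => rfl⟩,
    PNSym.extMul_assoc k, PNSym.intMul_assoc k⟩
  · exact (LinearMap.congr_fun TensorProduct.map_id (PNSym.comul k f)).symm
  · have h : (fun n => (PNSym.grade k n).map (LinearEquiv.refl k (PNSym k)).toLinearMap) =
        PNSym.grade k := funext fun n => Submodule.map_id _
    open PNSym in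
    rw [h]
    exact ⟨inferInstance⟩
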